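/- Let $\mathbb{F}_q$ be a finite field with $q$ elements, let $f_1,\ldots,f_r\in\mathbb{F}_q[x_1,\ldots,x_n]$ be polynomials, let $d_i$ be the total degree of $f_i$ (with the convention that the zero polynomial has total degree $0$), and put $d=d_1+\cdots+d_r$. For a subset $S\subseteq\mathbb{A}^n(\mathbb{F}_q)=\mathbb{F}_q^n$ let $$\mathcal{N}(S)=\#\{\mathbf{x}\in S: f_1(\mathbf{x})=\cdots=f_r(\mathbf{x})=0\}.$$ Then $$\mathcal{N}(L_1)\equiv\mathcal{N}(L_2)\pmod q$$ for any two parallel affine linear subspaces $L_1,L_2\subseteq\mathbb{A}^n(\mathbb{F}_q)$ of dimension $d$ or more, where parallel means that $L_2$ is a translate of $L_1$ (so that $L_1$ and $L_2$ have the same dimension). -/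

import Mathlib

open scoped Affine

/-- The set `z(f; S)` of common zeros in `S` of a system `f` of polynomials in `n` variables. -/
def zeroSet {F : Type*} [Field F] {n r : ℕ} (f : Fin r → MvPolynomial (Fin n) F)
    (S : Set (Fin n → F)) : Set (Fin n → F) :=
  {x | x ∈ S ∧ ∀ i, MvPolynomial.eval x (f i) = 0}

/-- The number `N(f; S)` of common zeros of the system `f` in `S`. -/
noncomputable def zeroCount {F : Type*} [Field F] {n r : ℕ}
    (f : Fin r → MvPolynomial (Fin n) F) (S : Set (Fin n → F)) : ℕ :=
  (zeroSet f S).ncard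

/-! Parametrize a subspace by `κ → F` and homogenize each restricted polynomial to the degree of the
original `f i`, even if restriction lowers it. The system then has one more variable than
parameters, hence more variables than its total degree, so Ax's theorem makes its number of zeros
divisible by `q`. The slice where the new variable is zero contributes `N₀`, the zeros of the
leading forms on the direction; each of the other `q - 1` slices contributes the count `N` on the
subspace. Hence `N ≡ N₀` mod `q`, and `N₀` sees only the direction, which parallel subspaces share.

Ax's theorem is proved for one polynomial by lifting it to Witt vectors with Teichmüller
coefficients and expanding its power of exponent `(q - 1) * q`, which indicates nonvanishing mod
`q`. In each term either a power sum over `F` or, by digit sums, the multinomial coefficient is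
divisible by `q`. Inclusion-exclusion passes to systems. -/

/-! ### Digit sums and divisibility of multinomial coefficients -/

-- If `k` has base-`p` digits `c m`, then `φ i` is the sum of `c m * p ^ ((m + i) % f)`. Over one
-- period in `i` each digit meets every power `p ^ 0, …, p ^ (f - 1)` once, which gives the digit
-- sum.
open Finset in
theorem exists_cyclic_digit_fold {p f : ℕ} (hp : 2 ≤ p) (k : ℕ) :
    ∃ φ : ℕ → ℕ, (∀ i, φ (i + f) = φ i) ∧ (∀ i, p ^ i * k ≡ φ i [MOD p ^ f - 1]) ∧
      (k ≠ 0 → ∀ i, 0 < φ i) ∧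
      (p - 1) * ∑ i ∈ range f, φ i = (p ^ f - 1) * (p.digits k).sum := by
  induction k using Nat.strong_induction_on with
  | _ k ih =>
  rcases Nat.eq_zero_or_pos k with rfl | hk
  · exact ⟨fun _ => 0, by simp, by simp [Nat.ModEq], by simp, by simp⟩
  obtain ⟨φ, hper, hmod, hpos, hsum⟩ := ih (k / p) (Nat.div_lt_self hk hp)
  have hone : p ^ f ≡ 1 [MOD p ^ f - 1] :=
    ((Nat.modEq_iff_dvd' (Nat.one_le_pow _ _ (by omega))).2 dvd_rfl).symm
  have hpow (i : ℕ) : p ^ i ≡ p ^ (i % f) [MOD p ^ f - 1] := by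
    conv_lhs => rw [← Nat.mod_add_div i f, pow_add, pow_mul]
    simpa using (Nat.ModEq.refl (p ^ (i % f))).mul (hone.pow (i / f))
  refine ⟨fun i => k % p * p ^ (i % f) + φ (i + 1), fun i => ?_, fun i => ?_, fun _ i => ?_, ?_⟩
  · simp only [Nat.add_mod_right]
    rw [show i + f + 1 = i + 1 + f by ring, hper]
  · have h := ((hpow i).mul_right (k % p)).add (hmod (i + 1))
    have e : p ^ i * (k % p) + p ^ (i + 1) * (k / p) = p ^ i * k := by
      conv_rhs => rw [← Nat.mod_add_div k p]
      ring
    rw [e] at h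
    simpa [mul_comm] using h
  · by_cases h : k / p = 0
    · have : k % p = k := Nat.mod_eq_of_lt ((Nat.div_eq_zero_iff_lt (by omega)).1 h)
      rw [this]
      positivity
    · have := hpos h (i + 1)
      positivity
  · have hshift : ∑ i ∈ range f, φ (i + 1) = ∑ i ∈ range f, φ i := by
      have h := (sum_range_succ' φ f).symm.trans (sum_range_succ φ f)
      have := hper 0
      simp only [zero_add] at this
      omega
    have hgeom : (p - 1) * ∑ i ∈ range f, p ^ (i % f) = p ^ f - 1 := by
      rw [sum_congr rfl fun i hi => by rw [Nat.mod_eq_of_lt (mem_range.1 hi)], mul_comm]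
      exact geom_sum_mul_of_one_le (by omega) f
    rw [sum_add_distrib, ← mul_sum, hshift, Nat.digits_def' hp hk, List.sum_cons, mul_add, hsum,
      mul_left_comm, hgeom]
    ring

theorem sum_digits_mul_pow {p : ℕ} (hp : 2 ≤ p) (f a : ℕ) :
    (p.digits (a * p ^ f)).sum = (p.digits a).sum := by
  rcases Nat.eq_zero_or_pos a with rfl | ha
  · simp
  · rw [mul_comm, Nat.digits_base_pow_mul hp ha]
    simp

theorem sum_digits_pow_sub_one {p : ℕ} (hp : 2 ≤ p) (f : ℕ) :
    (p.digits (p ^ f - 1)).sum = f * (p - 1) := by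
  induction f with
  | zero => simp
  | succ f ih =>
    have h1 : 1 ≤ p ^ f := Nat.one_le_pow _ _ (by omega)
    have e : p ^ (f + 1) - 1 = (p - 1) + p * (p ^ f - 1) := by
      rw [pow_succ']
      obtain ⟨c, hc⟩ := Nat.exists_eq_add_of_le h1
      rw [hc]
      simp only [Nat.add_sub_cancel_left, mul_add]
      omega
    rcases Nat.eq_zero_or_pos (p ^ f - 1) with h0 | h0
    · rw [h0] at ih
      rw [e, h0, Nat.digits_of_lt p _ (by omega) (by omega)]
      simp only [Nat.digits_zero, List.sum_nil] at ih
      simp [add_mul, ← ih]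
    · rw [e, Nat.digits_add p (by omega) _ _ (by omega) (Or.inl (by omega)), List.sum_cons, ih]
      ring

theorem padicValNat_finset_prod {ι : Type*} {p : ℕ} [Fact p.Prime] (s : Finset ι) (g : ι → ℕ)
    (hg : ∀ i, g i ≠ 0) : padicValNat p (∏ i ∈ s, g i) = ∑ i ∈ s, padicValNat p (g i) := by
  induction s using Finset.cons_induction with
  | empty => simp
  | cons a s ha ih =>
    rw [Finset.prod_cons, Finset.sum_cons,
      padicValNat.mul (hg a) (Finset.prod_ne_zero_iff.2 fun i _ => hg i), ih]

-- By Legendre's formula, `p - 1` times the valuation is the sum of the digit sums of the `k u`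
-- minus `f * (p - 1)`, the digit sum of the total. It suffices that the former is at least twice
-- the latter.
open Finset in
theorem pow_dvd_multinomial {ι σ : Type*} [Fintype σ] {p f d : ℕ} [Fact p.Prime]
    (s : Finset ι) (k : ι → ℕ) (w : ι → σ → ℕ) (hw : ∀ u ∈ s, ∑ j, w u j ≤ d)
    (hd : d < Fintype.card σ) (hk : ∑ u ∈ s, k u = (p ^ f - 1) * p ^ f)
    (hpos : ∀ j, ∑ u ∈ s, k u * w u j ≠ 0)
    (hdvd : ∀ j, p ^ f - 1 ∣ ∑ u ∈ s, k u * w u j) :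
    p ^ f ∣ Nat.multinomial s k := by
  have hp2 : 2 ≤ p := (Fact.out : p.Prime).two_le
  rcases Nat.eq_zero_or_pos f with rfl | hf
  · simp
  have hq : 0 < p ^ f - 1 := Nat.sub_pos_of_lt (Nat.one_lt_pow hf.ne' hp2)
  choose φ _ hmod hφpos hsum using fun u => exists_cyclic_digit_fold (f := f) hp2 (k u)
  have hmodsum (i : ℕ) (v : ι → ℕ) :
      p ^ i * ∑ u ∈ s, k u * v u ≡ ∑ u ∈ s, φ u i * v u [MOD p ^ f - 1] := by
    rw [mul_sum]
    refine Nat.ModEq.sum fun u _ => ?_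
    rw [← mul_assoc]
    exact (hmod u i).mul_right _
  have hdvdsum (i : ℕ) (v : ι → ℕ) (h : p ^ f - 1 ∣ ∑ u ∈ s, k u * v u) :
      p ^ f - 1 ∣ ∑ u ∈ s, φ u i * v u :=
    ((hmodsum i v).dvd_iff dvd_rfl).1 (h.mul_left _)
  -- The sum is a multiple `c * (p ^ f - 1)`. Each variable has folded exponent at least `p ^ f -
  -- 1`, so adding over variables gives `card σ ≤ d * c`, and `d < card σ` excludes `c ≤ 1`.
  have hlow (i : ℕ) : 2 * (p ^ f - 1) ≤ ∑ u ∈ s, φ u i := by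
    have h1 (j : σ) : p ^ f - 1 ≤ ∑ u ∈ s, φ u i * w u j := by
      refine Nat.le_of_dvd ?_ (hdvdsum i _ (hdvd j))
      obtain ⟨u, hu, hne⟩ := exists_ne_zero_of_sum_ne_zero (hpos j)
      have := hφpos u (left_ne_zero_of_mul hne) i
      have := Nat.pos_of_ne_zero (right_ne_zero_of_mul hne)
      exact lt_of_lt_of_le (by positivity)
        (single_le_sum (f := fun u => φ u i * w u j) (fun _ _ => Nat.zero_le _) hu)
    have h2 : Fintype.card σ * (p ^ f - 1) ≤ d * ∑ u ∈ s, φ u i := by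
      calc Fintype.card σ * (p ^ f - 1) = ∑ _j : σ, (p ^ f - 1) := by simp
        _ ≤ ∑ j, ∑ u ∈ s, φ u i * w u j := sum_le_sum fun j _ => h1 j
        _ = ∑ u ∈ s, φ u i * ∑ j, w u j := by rw [sum_comm]; simp only [mul_sum]
        _ ≤ ∑ u ∈ s, φ u i * d := sum_le_sum fun u hu => Nat.mul_le_mul_left _ (hw u hu)
        _ = d * ∑ u ∈ s, φ u i := by rw [← sum_mul, mul_comm]
    obtain ⟨c, hc⟩ : p ^ f - 1 ∣ ∑ u ∈ s, φ u i := by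
      simpa using hdvdsum i (fun _ => 1) (by simp [hk])
    rw [hc] at h2 ⊢
    have h3 : Fintype.card σ ≤ d * c := by
      refine Nat.le_of_mul_le_mul_right ?_ hq
      linarith [h2, mul_assoc d (p ^ f - 1) c, mul_right_comm d c (p ^ f - 1)]
    have h4 : 2 ≤ c := by
      by_contra! h
      have : d * c ≤ d * 1 := Nat.mul_le_mul_left _ (by omega)
      omega
    rw [mul_comm]
    exact Nat.mul_le_mul_left _ h4
  have hdig : 2 * (f * (p - 1)) ≤ ∑ u ∈ s, (p.digits (k u)).sum := by
    refine Nat.le_of_mul_le_mul_left ?_ hq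
    calc (p ^ f - 1) * (2 * (f * (p - 1))) = (p - 1) * ∑ _i ∈ range f, 2 * (p ^ f - 1) := by
          simp; ring
      _ ≤ (p - 1) * ∑ i ∈ range f, ∑ u ∈ s, φ u i :=
          Nat.mul_le_mul_left _ (sum_le_sum fun i _ => hlow i)
      _ = (p ^ f - 1) * ∑ u ∈ s, (p.digits (k u)).sum := by
          rw [sum_comm, mul_sum, mul_sum]
          exact sum_congr rfl fun u _ => hsum u
  have hval : ∑ u ∈ s, padicValNat p (k u).factorial + padicValNat p (Nat.multinomial s k) =
      padicValNat p ((p ^ f - 1) * p ^ f).factorial := by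
    rw [← hk, ← Nat.multinomial_spec s k,
      padicValNat.mul (prod_ne_zero_iff.2 fun u _ => Nat.factorial_ne_zero _)
        (Nat.multinomial_pos s k).ne', padicValNat_finset_prod]
    exact fun u => Nat.factorial_ne_zero _
  have hleg := congrArg ((p - 1) * ·) hval
  have hM := sub_one_mul_padicValNat_factorial (p := p) ((p ^ f - 1) * p ^ f)
  have hMd : (p.digits ((p ^ f - 1) * p ^ f)).sum = f * (p - 1) := by
    rw [sum_digits_mul_pow hp2, sum_digits_pow_sub_one hp2]
  have hks : ∑ u ∈ s, (p - 1) * padicValNat p (k u).factorial + ∑ u ∈ s, (p.digits (k u)).sum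
      = (p ^ f - 1) * p ^ f := by
    rw [← hk, ← sum_add_distrib]
    refine sum_congr rfl fun u _ => ?_
    rw [sub_one_mul_padicValNat_factorial]
    exact Nat.sub_add_cancel (Nat.digit_sum_le _ _)
  simp only [mul_add, mul_sum] at hleg
  have hle := Nat.digit_sum_le p ((p ^ f - 1) * p ^ f)
  have hfin : (p - 1) * f ≤ (p - 1) * padicValNat p (Nat.multinomial s k) := by
    rw [mul_comm f] at hMd hdig
    omega
  exact (padicValNat_dvd_iff_le (Nat.multinomial_pos s k).ne').2
    (Nat.le_of_mul_le_mul_left hfin (by omega))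

/-! ### Teichmüller lifts and congruences in Witt vectors -/

theorem WittVector.natCast_dvd_of_coeff_zero {p : ℕ} [Fact p.Prime] {F : Type*} [Field F]
    [CharP F p] [PerfectRing F p] {x : WittVector p F} (hx : x.coeff 0 = 0) :
    (p : WittVector p F) ∣ x := by
  rcases eq_or_ne x 0 with rfl | h0
  · exact dvd_zero _
  obtain ⟨m, b, hb, rfl⟩ := WittVector.exists_eq_pow_p_mul x h0
  rcases m with _ | m
  · simp [hb] at hx
  · exact (dvd_pow_self _ m.succ_ne_zero).mul_right _

theorem WittVector.natCast_pow_dvd_natCast {p : ℕ} [Fact p.Prime] {F : Type*} [Field F]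
    [CharP F p] {f N : ℕ} (h : (p : WittVector p F) ^ f ∣ (N : WittVector p F)) : p ^ f ∣ N := by
  induction f generalizing N with
  | zero => simp
  | succ f ih =>
    have h1 : p ∣ N := by
      have := (map_dvd (WittVector.constantCoeff (p := p) (R := F))
        ((dvd_pow_self (p : WittVector p F) f.succ_ne_zero).trans h))
      rw [map_natCast, map_natCast, CharP.cast_eq_zero, zero_dvd_iff] at this
      exact (CharP.cast_eq_zero_iff F p N).1 this
    obtain ⟨M, rfl⟩ := h1
    rw [pow_succ', Nat.cast_mul] at h
    rw [pow_succ']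
    exact mul_dvd_mul_left _ (ih ((mul_dvd_mul_iff_left (WittVector.p_nonzero p F)).1 h))

/-- The exponent `p ^ f - 1` makes a unit congruent to 1 mod `p`, and the further `p ^ f`-th power
lifts this beyond `p ^ f`. A nonunit is divisible by `p`, and the exponent is at least `f`. -/
theorem WittVector.pow_dvd_one_sub_pow_sub_ite {p : ℕ} [Fact p.Prime] {F : Type*} [Field F]
    [Fintype F] [DecidableEq F] [CharP F p] {f : ℕ} (hq : Fintype.card F = p ^ f)
    (x : WittVector p F) :
    (p : WittVector p F) ^ f ∣
      1 - x ^ ((p ^ f - 1) * p ^ f) - if x.coeff 0 = 0 then 1 else 0 := by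
  have hp := (Fact.out : p.Prime)
  have hlt : f < p ^ f := Nat.lt_pow_self hp.one_lt
  split_ifs with h
  · have hd : f ≤ (p ^ f - 1) * p ^ f := by
      have : 1 < p ^ f := hq ▸ Fintype.one_lt_card
      exact hlt.le.trans (Nat.le_mul_of_pos_left _ (by omega))
    rw [sub_sub_cancel_left, dvd_neg]
    exact (pow_dvd_pow _ hd).trans (pow_dvd_pow_of_dvd (natCast_dvd_of_coeff_zero h) _)
  · have h1 : (p : WittVector p F) ∣ 1 - x ^ (p ^ f - 1) := by
      refine natCast_dvd_of_coeff_zero ?_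
      change WittVector.constantCoeff (1 - x ^ (p ^ f - 1)) = 0
      rw [map_sub, map_one, map_pow, ← hq]
      change 1 - x.coeff 0 ^ _ = 0
      rw [FiniteField.pow_card_sub_one_eq_one _ h, sub_self]
    have h2 := dvd_sub_pow_of_dvd_sub h1 f
    rw [one_pow, ← pow_mul] at h2
    rw [sub_zero]
    exact (pow_dvd_pow _ f.le_succ).trans h2

/-- For `e = 0` the sum is `p ^ f`. Otherwise some unit `u` has `u ^ e ≠ 1`, and the substitution `a
↦ u * a` forces the sum to vanish. -/
theorem WittVector.pow_dvd_sum_teichmuller_pow {p : ℕ} [Fact p.Prime] {F : Type*} [Field F]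
    [Fintype F] [CharP F p] {f e : ℕ} (hq : Fintype.card F = p ^ f)
    (he : e = 0 ∨ ¬ p ^ f - 1 ∣ e) :
    (p : WittVector p F) ^ f ∣ ∑ a : F, teichmuller p a ^ e := by
  rcases he with rfl | he
  · simp [hq]
  · have h0 : ∑ a : F, teichmuller p a ^ e = 0 := by
      rw [← hq, ← FiniteField.forall_pow_eq_one_iff F e] at he
      push Not at he
      obtain ⟨u, hu⟩ := he
      have h1 : ∑ a : F, teichmuller p a ^ e
          = teichmuller p (u : F) ^ e * ∑ a : F, teichmuller p a ^ e := by
        rw [Finset.mul_sum]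
        refine (Fintype.sum_equiv (Equiv.mulLeft₀ (u : F) u.ne_zero) _ _ fun a => ?_).symm
        simp [mul_pow]
      have h2 : (teichmuller p (u : F) ^ e - 1) * ∑ a : F, teichmuller p a ^ e = 0 := by
        rw [sub_mul, one_mul, ← h1, sub_self]
      refine (mul_eq_zero.1 h2).resolve_left fun h3 => hu ?_
      rw [sub_eq_zero, ← map_pow] at h3
      have h4 := congrArg (fun w : WittVector p F => w.coeff 0) h3
      simp only [teichmuller_coeff_zero, one_coeff_zero] at h4
      exact Units.ext (by simpa using h4)
    simp [h0]

theorem WittVector.pow_dvd_sum_prod_teichmuller_pow {p : ℕ} [Fact p.Prime] {F σ : Type*} [Field F]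
    [Fintype F] [CharP F p] [Fintype σ] [DecidableEq σ] {f : ℕ} (hq : Fintype.card F = p ^ f) {e : σ → ℕ}
    (he : ∃ j, e j = 0 ∨ ¬ p ^ f - 1 ∣ e j) :
    (p : WittVector p F) ^ f ∣ ∑ x : σ → F, ∏ j, teichmuller p (x j) ^ e j := by
  obtain ⟨j, hj⟩ := he
  have h := Finset.prod_univ_sum (fun _ : σ => (Finset.univ : Finset F))
    (fun j a => teichmuller p a ^ e j)
  rw [Fintype.piFinset_univ] at h
  rw [← h]
  exact (pow_dvd_sum_teichmuller_pow hq hj).trans (Finset.dvd_prod_of_mem _ (Finset.mem_univ j))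

open Finset in
theorem MvPolynomial.pow_dvd_sum_teichmuller_lift_pow {p : ℕ} [Fact p.Prime] {F σ : Type*}
    [Field F] [Fintype F] [CharP F p] [Fintype σ] [DecidableEq σ] {f : ℕ} (hq : Fintype.card F = p ^ f)
    (g : MvPolynomial σ F) (hg : g.totalDegree < Fintype.card σ) :
    (p : WittVector p F) ^ f ∣
      ∑ x : σ → F, (∑ u ∈ g.support, WittVector.teichmuller p (g.coeff u) *
        ∏ j, WittVector.teichmuller p (x j) ^ u j) ^ ((p ^ f - 1) * p ^ f) := by
  classical
  simp_rw [sum_pow_eq_sum_piAntidiag]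
  rw [sum_comm]
  refine dvd_sum fun k hk => ?_
  rw [← mul_sum]
  have hsplit : ∑ x : σ → F, ∏ u ∈ g.support, (WittVector.teichmuller p (g.coeff u) *
        ∏ j, WittVector.teichmuller p (x j) ^ u j) ^ k u =
      (∏ u ∈ g.support, WittVector.teichmuller p (g.coeff u) ^ k u) *
        ∑ x : σ → F, ∏ j, WittVector.teichmuller p (x j) ^ ∑ u ∈ g.support, k u * u j := by
    rw [mul_sum]
    refine sum_congr rfl fun x _ => ?_
    simp_rw [mul_pow, prod_mul_distrib, ← prod_pow, ← pow_mul]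
    rw [prod_comm]
    simp_rw [prod_pow_eq_pow_sum, mul_comm (k _)]
  rw [hsplit]
  -- One bad exponent makes the power sum divisible; if all are positive multiples of `p ^ f - 1`,
  -- the multinomial coefficient is.
  by_cases he : ∃ j, ∑ u ∈ g.support, k u * u j = 0 ∨ ¬ p ^ f - 1 ∣ ∑ u ∈ g.support, k u * u j
  · exact ((WittVector.pow_dvd_sum_prod_teichmuller_pow hq he).mul_left _).mul_left _
  · push Not at he
    have h := pow_dvd_multinomial g.support k (fun u j => u j) (fun u hu => ?_) hg
      (mem_piAntidiag.1 hk).1 (fun j => (he j).1) (fun j => (he j).2)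
    · refine Dvd.dvd.mul_right ?_ _
      exact_mod_cast Nat.cast_dvd_cast (α := WittVector p F) h
    · have := le_totalDegree hu
      rwa [Finsupp.sum_fintype _ _ fun _ => rfl] at this

/-! ### Ax's theorem modulo `q` -/

open Finset in
theorem MvPolynomial.card_dvd_card_zeros {F σ : Type*} [Field F] [Fintype F] [DecidableEq F]
    [Fintype σ] [DecidableEq σ] (g : MvPolynomial σ F) (hg : g.totalDegree < Fintype.card σ) :
    Fintype.card F ∣ #{x : σ → F | eval x g = 0} := by
  obtain ⟨p, hchar⟩ := CharP.exists F
  obtain ⟨f, hp, hq⟩ := FiniteField.card F p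
  have := Fact.mk hp
  rw [hq]
  refine WittVector.natCast_pow_dvd_natCast (F := F) ?_
  set G : (σ → F) → WittVector p F := fun x => ∑ u ∈ g.support,
    WittVector.teichmuller p (g.coeff u) * ∏ j, WittVector.teichmuller p (x j) ^ u j with hG
  have hcoeff (x : σ → F) : (G x).coeff 0 = eval x g := by
    change WittVector.constantCoeff (G x) = _
    rw [eval_eq', hG, map_sum]
    refine sum_congr rfl fun u _ => ?_
    rw [map_mul, map_prod]
    simp_rw [map_pow]
    rfl
  have h1 : (p : WittVector p F) ^ (f : ℕ) ∣ ∑ x : σ → F,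
      (1 - G x ^ ((p ^ (f : ℕ) - 1) * p ^ (f : ℕ)) - if (G x).coeff 0 = 0 then 1 else 0) :=
    dvd_sum fun x _ => WittVector.pow_dvd_one_sub_pow_sub_ite hq (G x)
  have h2 := pow_dvd_sum_teichmuller_lift_pow hq g hg
  have h3 : (p : WittVector p F) ^ (f : ℕ) ∣ ∑ _x : σ → F, (1 : WittVector p F) := by
    have : Fintype.card σ ≠ 0 := by omega
    simp only [sum_const, card_univ, Fintype.card_fun, hq, nsmul_eq_mul, mul_one, Nat.cast_pow]
    exact dvd_pow_self _ this
  have h4 : ((#{x : σ → F | eval x g = 0} : ℕ) : WittVector p F)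
      = ∑ x : σ → F, if (G x).coeff 0 = 0 then 1 else 0 := by
    simp [hcoeff]
  rw [h4]
  simp_rw [sum_sub_distrib] at h1
  exact (dvd_sub_right (dvd_sub h3 h2)).1 h1

open Finset in
/-- Ax's strengthening of the Chevalley–Warning theorem, modulo the size of the field. -/
theorem MvPolynomial.card_dvd_card_common_zeros {F σ ι : Type*} [Field F] [Fintype F]
    [DecidableEq F] [Fintype σ] [DecidableEq σ] [Fintype ι]
    (g : ι → MvPolynomial σ F) (hg : ∑ i, (g i).totalDegree < Fintype.card σ) :
    Fintype.card F ∣ #{x : σ → F | ∀ i, eval x (g i) = 0} := by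
  classical
  have hie := inclusion_exclusion_card_inf_compl (univ : Finset ι)
    (fun i => ({x : σ → F | eval x (g i) ≠ 0} : Finset (σ → F)))
  have hinf : (univ : Finset ι).inf (fun i => ({x : σ → F | eval x (g i) ≠ 0} : Finset (σ → F))ᶜ)
      = ({x : σ → F | ∀ i, eval x (g i) = 0} : Finset (σ → F)) := by
    ext x; simp [Finset.mem_inf]
  rw [hinf] at hie
  rw [← Int.natCast_dvd_natCast, hie]
  refine dvd_sum fun t _ => Dvd.dvd.mul_left ?_ _
  -- Simultaneous nonvanishing is nonvanishing of the product, so only the single-polynomial case is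
  -- needed.
  have ht : t.inf (fun i => ({x : σ → F | eval x (g i) ≠ 0} : Finset (σ → F)))
      = ({x : σ → F | eval x (∏ i ∈ t, g i) = 0} : Finset (σ → F))ᶜ := by
    ext x; simp [Finset.mem_inf, map_prod, prod_eq_zero_iff]
  rw [ht, Int.natCast_dvd_natCast, card_compl]
  refine Nat.dvd_sub ?_ (card_dvd_card_zeros _ ?_)
  · rw [Fintype.card_fun]
    exact dvd_pow_self _ (by omega)
  · exact ((totalDegree_finsetProd _ _).trans
      (sum_le_sum_of_subset (subset_univ t))).trans_lt hg

/-! ### Homogenized restrictions and leading forms -/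

theorem MvPolynomial.IsHomogeneous.eval_mul_left {R σ : Type*} [CommSemiring R]
    {φ : MvPolynomial σ R} {k : ℕ} (hφ : φ.IsHomogeneous k) (t : R) (x : σ → R) :
    eval (fun l => t * x l) φ = t ^ k * eval x φ := by
  rw [eval_eq, eval_eq, Finset.mul_sum]
  refine Finset.sum_congr rfl fun u hu => ?_
  rw [hφ.degree_eq_sum_deg_support hu]
  simp_rw [mul_pow, Finset.prod_mul_distrib, Finset.prod_pow_eq_pow_sum]
  ring

open Finset in
/-- The homogenization of the restriction of `f` to the affine subspace through `a` that is spanned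
by the directions `b`; the variable `none` is the homogenizing one. -/
noncomputable def MvPolynomial.homogenizedRestriction {R σ κ : Type*} [CommRing R] [Fintype κ]
    (a : σ → R) (b : κ → σ → R) (f : MvPolynomial σ R) : MvPolynomial (Option κ) R :=
  ∑ k ∈ range (f.totalDegree + 1), X none ^ (f.totalDegree - k) *
    aeval (fun l => C (a l) * X none + ∑ j, C (b j l) * X (some j)) (homogeneousComponent k f)

namespace MvPolynomial

variable {R σ κ : Type*} [CommRing R] [Fintype κ]

theorem totalDegree_homogenizedRestriction_le (a : σ → R) (b : κ → σ → R)
    (f : MvPolynomial σ R) : (homogenizedRestriction a b f).totalDegree ≤ f.totalDegree := by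
  refine IsHomogeneous.totalDegree_le (IsHomogeneous.sum _ _ _ fun k hk => ?_)
  have hlin : ∀ l, (C (a l) * X none + ∑ j, C (b j l) * X (some j) :
      MvPolynomial (Option κ) R).IsHomogeneous 1 := fun l =>
    (isHomogeneous_C_mul_X _ _).add (IsHomogeneous.sum _ _ _ fun j _ => isHomogeneous_C_mul_X _ _)
  have h := (isHomogeneous_X_pow (R := R) (none : Option κ) (f.totalDegree - k)).mul
    ((homogeneousComponent_isHomogeneous k f).aeval _ hlin)
  rwa [one_mul, Nat.sub_add_cancel (Nat.lt_succ_iff.1 (Finset.mem_range.1 hk))] at h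

theorem eval_homogenizedRestriction (a : σ → R) (b : κ → σ → R) (f : MvPolynomial σ R)
    (z : Option κ → R) :
    eval z (homogenizedRestriction a b f) = ∑ k ∈ Finset.range (f.totalDegree + 1),
      z none ^ (f.totalDegree - k) *
        eval (fun l => a l * z none + ∑ j, b j l * z (some j)) (homogeneousComponent k f) := by
  rw [homogenizedRestriction, map_sum]
  refine Finset.sum_congr rfl fun k _ => ?_
  have hid : (eval z).comp (algebraMap R (MvPolynomial (Option κ) R)) = RingHom.id R := by
    ext c
    simp
  have harg : (fun l => eval z (C (a l) * X none + ∑ j, C (b j l) * X (some j))) =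
      fun l => a l * z none + ∑ j, b j l * z (some j) := by
    funext l
    simp
  rw [map_mul, map_pow, eval_X, map_aeval, hid, harg]
  rfl

theorem eval_homogenizedRestriction_of_eq_zero (a : σ → R) (b : κ → σ → R)
    (f : MvPolynomial σ R) {z : Option κ → R} (hz : z none = 0) :
    eval z (homogenizedRestriction a b f) =
      eval (fun l => ∑ j, b j l * z (some j)) (homogeneousComponent f.totalDegree f) := by
  rw [eval_homogenizedRestriction, Finset.sum_range_succ, Finset.sum_eq_zero]
  · simp [hz]
  · intro k hk
    have := Finset.mem_range.1 hk
    rw [hz, zero_pow (by omega), zero_mul]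

theorem eval_homogenizedRestriction_mul (a : σ → R) (b : κ → σ → R)
    (f : MvPolynomial σ R) {z : Option κ → R} {y : κ → R} (hz : ∀ j, z (some j) = z none * y j) :
    eval z (homogenizedRestriction a b f) =
      z none ^ f.totalDegree * eval (fun l => a l + ∑ j, b j l * y j) f := by
  have harg : (fun l => a l * z none + ∑ j, b j l * z (some j)) =
      fun l => z none * (a l + ∑ j, b j l * y j) := by
    funext l
    simp only [hz, mul_add, Finset.mul_sum]
    congr 1
    · ring
    · exact Finset.sum_congr rfl fun j _ => by ring
  rw [eval_homogenizedRestriction, harg]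
  conv_rhs => rw [← sum_homogeneousComponent f, map_sum, Finset.mul_sum]
  rw [sum_homogeneousComponent f]
  refine Finset.sum_congr rfl fun k hk => ?_
  rw [(homogeneousComponent_isHomogeneous k f).eval_mul_left, ← mul_assoc, ← pow_add,
    Nat.sub_add_cancel (Nat.lt_succ_iff.1 (Finset.mem_range.1 hk))]

open Finset in
/-- On an affine subspace of dimension at least the total degree of the system, the number of zeros
is determined modulo the size of the field by the leading forms on the direction. -/
theorem card_zeros_modEq_card_leading_zeros {F σ κ ι : Type*} [Field F] [Fintype F]
    [DecidableEq F] [Fintype κ] [DecidableEq κ] [Fintype ι] (f : ι → MvPolynomial σ F)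
    (a : σ → F) (b : κ → σ → F) (hf : ∑ i, (f i).totalDegree ≤ Fintype.card κ) :
    {y : κ → F | ∀ i, eval (fun l => a l + ∑ j, b j l * y j) (f i) = 0}.ncard ≡
      {y : κ → F | ∀ i, eval (fun l => ∑ j, b j l * y j)
        (homogeneousComponent (f i).totalDegree (f i)) = 0}.ncard [MOD Fintype.card F] := by
  have hncard (P : (κ → F) → Prop) [DecidablePred P] : {y | P y}.ncard = #{y | P y} := by
    rw [← Set.ncard_coe_finset, coe_filter_univ]
  rw [hncard, hncard]
  have hax := card_dvd_card_common_zeros (fun i => homogenizedRestriction a b (f i)) (by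
    rw [Fintype.card_option]
    exact Nat.lt_succ_of_le ((sum_le_sum fun i _ =>
      totalDegree_homogenizedRestriction_le a b (f i)).trans hf))
  set N := #{y : κ → F | ∀ i, eval (fun l => a l + ∑ j, b j l * y j) (f i) = 0} with hN
  set N₀ := #{y : κ → F | ∀ i, eval (fun l => ∑ j, b j l * y j)
        (homogeneousComponent (f i).totalDegree (f i)) = 0} with hN₀
  -- Scaling by `t⁻¹` carries the slice at `t` to the slice at 1, the affine system itself.
  have hslice (t : F) (ht : t ≠ 0) : #{y : κ → F | ∀ i, eval
      ((Equiv.piOptionEquivProd (β := fun _ => F)).symm (t, y))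
        (homogenizedRestriction a b (f i)) = 0} = N := by
    refine card_nbij' (fun y j => t⁻¹ * y j) (fun y j => t * y j) ?_ ?_ ?_ ?_
    · intro y hy
      simp only [coe_filter, mem_univ, true_and, Set.mem_ofPred_eq] at hy ⊢
      intro i
      have h := hy i
      rw [eval_homogenizedRestriction_mul a b (f i) (y := fun j => t⁻¹ * y j)
        (fun j => (mul_inv_cancel_left₀ ht (y j)).symm)] at h
      exact (mul_eq_zero.1 h).resolve_left (pow_ne_zero _ ht)
    · intro y hy
      simp only [coe_filter, mem_univ, true_and, Set.mem_ofPred_eq] at hy ⊢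
      intro i
      rw [eval_homogenizedRestriction_mul a b (f i) (y := y) (fun j => rfl), hy i, mul_zero]
    · intro y _
      funext j
      exact mul_inv_cancel_left₀ ht _
    · intro y _
      funext j
      exact inv_mul_cancel_left₀ ht _
  have hzero : #{y : κ → F | ∀ i, eval
      ((Equiv.piOptionEquivProd (β := fun _ => F)).symm (0, y))
        (homogenizedRestriction a b (f i)) = 0} = N₀ := by
    refine congrArg card (filter_congr fun y _ => forall_congr' fun i => ?_)
    rw [eval_homogenizedRestriction_of_eq_zero a b (f i) rfl]
    rfl
  have hcount : #{z : Option κ → F | ∀ i, eval z (homogenizedRestriction a b (f i)) = 0}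
      = N₀ + (Fintype.card F - 1) * N := by
    rw [card_filter, ← (Equiv.piOptionEquivProd (β := fun _ => F)).symm.sum_comp,
      Fintype.sum_prod_type]
    simp_rw [← card_filter]
    rw [Fintype.sum_eq_add_sum_compl 0, hzero,
      sum_congr rfl fun t ht => hslice t (by simpa using ht), sum_const, card_compl,
      card_singleton, smul_eq_mul]
  rw [hcount] at hax
  have h1 : N₀ + (Fintype.card F - 1) * N + N = N₀ + Fintype.card F * N := by
    obtain ⟨c, hc⟩ := Nat.exists_eq_add_of_lt (Fintype.card_pos (α := F))
    rw [hc]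
    simp only [zero_add, Nat.add_sub_cancel]
    ring
  calc N = 0 + N := (zero_add N).symm
    _ ≡ (N₀ + (Fintype.card F - 1) * N) + N [MOD Fintype.card F] :=
        ((Nat.modEq_zero_iff_dvd.2 hax).symm).add_right N
    _ = N₀ + Fintype.card F * N := h1
    _ ≡ N₀ + 0 [MOD Fintype.card F] :=
        (Nat.modEq_zero_iff_dvd.2 (dvd_mul_right _ _)).add_left N₀
    _ = N₀ := add_zero N₀

end MvPolynomial

/-! ### Parametrization of affine subspaces and conclusion -/

theorem zeroCount_eq_card_parameters {F : Type*} [Field F] {n r : ℕ}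
    {κ : Type*} [Fintype κ] (f : Fin r → MvPolynomial (Fin n) F)
    {L : AffineSubspace F (Fin n → F)} {a : Fin n → F} (ha : a ∈ L) {b : κ → Fin n → F}
    (hb : LinearIndependent F b) (hspan : Submodule.span F (Set.range b) = L.direction) :
    zeroCount f (L : Set (Fin n → F)) =
      {y : κ → F | ∀ i, MvPolynomial.eval (fun l => a l + ∑ j, b j l * y j) (f i) = 0}.ncard := by
  have hφ (y : κ → F) : (fun l => a l + ∑ j, b j l * y j) = (∑ j, y j • b j) +ᵥ a := by
    funext l
    simp [add_comm, mul_comm]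
  have hinj : Function.Injective fun y : κ → F => fun l => a l + ∑ j, b j l * y j := by
    intro y y' h
    simp only [hφ] at h
    exact hb.fintypeLinearCombination_injective (by
      simpa [Fintype.linearCombination_apply] using h)
  have himage : zeroSet f (L : Set (Fin n → F)) =
      (fun y : κ → F => fun l => a l + ∑ j, b j l * y j) ''
        {y | ∀ i, MvPolynomial.eval (fun l => a l + ∑ j, b j l * y j) (f i) = 0} := by
    ext x
    constructor
    · rintro ⟨hx, hz⟩
      have hv : x -ᵥ a ∈ Submodule.span F (Set.range b) :=
        hspan ▸ AffineSubspace.vsub_mem_direction hx ha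
      obtain ⟨y, hy⟩ := (Submodule.mem_span_range_iff_exists_fun F).1 hv
      have hxy : (fun l => a l + ∑ j, b j l * y j) = x := by
        rw [hφ, hy, vsub_vadd]
      exact ⟨y, fun i => by rw [hxy]; exact hz i, hxy⟩
    · rintro ⟨y, hy, rfl⟩
      refine ⟨?_, hy⟩
      have : (∑ j, y j • b j) +ᵥ a ∈ L := AffineSubspace.vadd_mem_of_mem_direction
        (hspan ▸ (Submodule.mem_span_range_iff_exists_fun F).2 ⟨y, rfl⟩) ha
      rw [← hφ] at this
      exact this
  rw [zeroCount, himage, Set.ncard_image_of_injective _ hinj]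

theorem Submodule.exists_linearIndependent_span_eq {K V : Type*} [Field K] [AddCommGroup V]
    [Module K V] [FiniteDimensional K V] (D : Submodule K V) :
    ∃ b : Fin (Module.finrank K D) → V,
      LinearIndependent K b ∧ Submodule.span K (Set.range b) = D := by
  let b := Module.finBasis K D
  refine ⟨fun j => b j, b.linearIndependent.map' D.subtype (Submodule.ker_subtype _), ?_⟩
  have : (Set.range fun j => (b j : V)) = D.subtype '' Set.range b := by
    rw [← Set.range_comp]
    rfl
  rw [this, Submodule.span_image, b.span_eq, Submodule.map_top, Submodule.range_subtype]

theorem theorem1 {F : Type*} [Field F] [Finite F] {n r : ℕ}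
    (f : Fin r → MvPolynomial (Fin n) F)
    (L₁ L₂ : AffineSubspace F (Fin n → F)) (hpar : L₁ ∥ L₂)
    (hdim : ∑ i, (f i).totalDegree ≤ Module.finrank F L₁.direction) :
    zeroCount f (L₁ : Set (Fin n → F)) ≡ zeroCount f (L₂ : Set (Fin n → F)) [MOD Nat.card F] := by
  classical
  have := Fintype.ofFinite F
  rcases L₁.eq_bot_or_nonempty with rfl | ⟨a₁, ha₁⟩
  · rw [AffineSubspace.bot_parallel_iff_eq_bot.1 hpar]
  rcases L₂.eq_bot_or_nonempty with rfl | ⟨a₂, ha₂⟩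
  · rw [AffineSubspace.parallel_bot_iff_eq_bot.1 hpar]
  obtain ⟨b, hb, hspan⟩ := L₁.direction.exists_linearIndependent_span_eq
  have hdeg : ∑ i, (f i).totalDegree ≤ Fintype.card (Fin (Module.finrank F L₁.direction)) := by
    rwa [Fintype.card_fin]
  rw [Nat.card_eq_fintype_card, zeroCount_eq_card_parameters f ha₁ hb hspan,
    zeroCount_eq_card_parameters f ha₂ hb (hspan.trans hpar.direction_eq)]
  -- The same `b` spans both directions, so both counts reduce to the same leading-form count.
  exact (MvPolynomial.card_zeros_modEq_card_leading_zeros f a₁ _ hdeg).trans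
    (MvPolynomial.card_zeros_modEq_card_leading_zeros f a₂ _ hdeg).symm
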